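/- For integers $1\le m\le d$ and $s\ge 1$ with $s\mid d$ and $s\mid m$, put $K=(d-m)/s$ and $Q_s^\ell(x)=(x_{\ell s+1},\dots,x_{\ell s+m})$ for $x\in\mathbb R^d$, $0\le\ell\le K$. Consider the networks $$F^{\mathsf{CA}}(x;w)=\sum_{\ell=0}^{K}w^\top Q_s^\ell(x)\quad(x\in\mathbb R^d,\ w\in\mathbb R^m),\qquad F^{\mathsf{CW}}(x;w,a)=\sum_{\ell=0}^{K}a_\ell\,w^\top Q_s^\ell(x)\quad(w\in\mathbb R^m,\ a\in\mathbb R^{K+1}),$$ and, for positive integers $r,d,L$ and $x=(x_1,\dots,x_L)\in(\mathbb R^d)^L$, $$F^{\mathsf R}(x;A,B)=\mathbf 1^\top h_L,\qquad h_0=0,\quad h_t=Ah_{t-1}+Bx_t\ (1\le t\le L),\qquad A\in\mathbb R^{r\times r},\ B\in\mathbb R^{r\times d}.$$ Let $\mu$ be the input law: $\mathcal N(0,I_d)$ on $\mathbb R^d$ for $F^{\mathsf{CA}}$ and $F^{\mathsf{CW}}$, and the law of $L$ i.i.d. $\mathcal N(0,I_d)$ vectors for $F^{\mathsf R}$. For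 each such $F$, with parameter space $\Theta$, one observes, for $i=1,\dots,n$ ($n\ge 1$), pairs $(X_i,Y_i)$ with $Y_i=F(X_i;\theta)+\xi_i$, where $X_1,\dots,X_n$ are i.i.d. from $\mu$ and, independently of them, $\xi_1,\dots,\xi_n$ are i.i.d. $\mathcal N(0,\sigma^2)$, $\sigma\ge 0$. Define $$\mathfrak M(n;F)=\inf_{\hat\theta}\ \sup_{\theta\in\Theta}\ \mathbb E_{\mu,\theta}\Big[\big(\mathbb E_{x\sim\mu}|F(x;\theta)-F(x;\hat\theta)|^2\big)^{1/2}\Big]\in[0,\infty],$$ where the infimum runs over all estimators, deterministic or randomized, taking the sample $(X_i,Y_i)_{i\le n}$ to an element $\hat\theta$ of $\Theta$. Then there is a universal constant $C>0$ such that, for all such $n,\sigma,d,m,s,r,L$, $$\mathfrak M(n;F^{\mathsf{CA}})\ge C\sqrt{\frac{\sigma^2m}{n}},\qquad \mathfrak M(n;F^{\mathsf{CW}})\ge C\sqrt{\frac{\sigma^2(m+d/s)}{n}},\qquad \mathfrak M(n;F^{\mathsf R})\ge C\sqrt{\frac{\sigma^2\min\{rd,Ld\}}{n}}.$$ -/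

import Mathlib

open MeasureTheory ProbabilityTheory
open scoped ENNReal NNReal Matrix

noncomputable section

/-- The root-mean-square prediction error
`err(θ', θ) = (E_{x ∼ μ} |F(x; θ) - F(x; θ')|²)^{1/2}` of the estimate `θ'` when the true parameter
is `θ`, with values in `[0, ∞]`. -/
def predErr {X Θ : Type*} [MeasurableSpace X] (F : X → Θ → ℝ) (μ : Measure X)
    (θ θ' : Θ) : ℝ≥0∞ :=
  (∫⁻ x, ‖F x θ - F x θ'‖ₑ ^ 2 ∂μ) ^ (1 / 2 : ℝ)

/-- The labelled sample `(Xᵢ, Yᵢ)`, `i < n`, with `Yᵢ = F(Xᵢ; θ) + ξᵢ`, computed from the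
parameter `p.1 = θ` and the inputs and noise variables `p.2 i = (Xᵢ, ξᵢ)`. -/
def labelledSample {X Θ : Type*} (F : X → Θ → ℝ) (n : ℕ) (p : Θ × (Fin n → X × ℝ)) :
    Fin n → X × ℝ :=
  fun i => ((p.2 i).1, F (p.2 i).1 p.1 + (p.2 i).2)

/-- The data generating process, as a kernel sending `θ` to the law of `(Xᵢ, Yᵢ)`, `i < n`, where
`Yᵢ = F(Xᵢ; θ) + ξᵢ`, the inputs `Xᵢ` are i.i.d. with law `μ`, the noise variables `ξᵢ` are i.i.d.
with law `ν`, and inputs and noise are independent. (It is used for jointly continuous `F` only,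
so that the map is measurable.) -/
def dataLaw {X Θ : Type*} [MeasurableSpace X] [MeasurableSpace Θ] (F : X → Θ → ℝ)
    (μ : Measure X) (ν : Measure ℝ) (n : ℕ) : Kernel Θ (Fin n → X × ℝ) :=
  (Kernel.id ×ₖ Kernel.const Θ (Measure.pi (fun _ : Fin n => μ.prod ν))).map
    (labelledSample F n)

/-- The minimax prediction risk: the infimum over all (possibly randomized) estimators, which turn
a sample of `n` labelled data points into a parameter, of the worst-case expected prediction
error. -/
def predRisk {X Θ : Type*} [MeasurableSpace X] [MeasurableSpace Θ] (F : X → Θ → ℝ)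
    (μ : Measure X) (ν : Measure ℝ) (n : ℕ) : ℝ≥0∞ :=
  ProbabilityTheory.minimaxRisk (predErr F μ) (dataLaw F μ ν n)

/-- The standard Gaussian law `N(0, I)` on `ℝ^d`: independent standard normal coordinates. -/
def gaussVec (d : ℕ) : Measure (Fin d → ℝ) := Measure.pi (fun _ => gaussianReal 0 1)

/-- The law of a sequence `x_1, …, x_L` of i.i.d. `N(0, I)` vectors in `ℝ^d`. -/
def gaussSeq (L d : ℕ) : Measure (Fin L → Fin d → ℝ) := Measure.pi (fun _ => gaussVec d)

theorem segment_index_lt {d m s : ℕ} (hmd : m ≤ d) (l : Fin ((d - m) / s + 1)) (j : Fin m) :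
    (l : ℕ) * s + j < d := by
  have h1 : (l : ℕ) * s ≤ (d - m) / s * s := Nat.mul_le_mul_right s (by omega)
  have h2 : (d - m) / s * s ≤ d - m := Nat.div_mul_le_self _ _
  have h3 := j.2
  omega

/-- The `l`-th segment `(x_{ls+1}, …, x_{ls+m})` of `x ∈ ℝ^d` (coordinates are numbered from `0`
here), for `l = 0, …, ⌊(d - m) / s⌋`. -/
def inputSegment {d m : ℕ} (s : ℕ) (hmd : m ≤ d) (x : Fin d → ℝ)
    (l : Fin ((d - m) / s + 1)) : Fin m → ℝ :=
  fun j => x ⟨(l : ℕ) * s + j, segment_index_lt hmd l j⟩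

/-- Convolutional network with filter `w`, stride `s` and average pooling. -/
def netCA {d m : ℕ} (s : ℕ) (hmd : m ≤ d) (x : Fin d → ℝ) (w : Fin m → ℝ) : ℝ :=
  ∑ l : Fin ((d - m) / s + 1), w ⬝ᵥ inputSegment s hmd x l

/-- Convolutional network with filter `w`, stride `s` and pooling weights `a`;
the parameter is `(w, a)`. -/
def netCW {d m : ℕ} (s : ℕ) (hmd : m ≤ d) (x : Fin d → ℝ)
    (θ : (Fin m → ℝ) × (Fin ((d - m) / s + 1) → ℝ)) : ℝ :=
  ∑ l : Fin ((d - m) / s + 1), θ.2 l * (θ.1 ⬝ᵥ inputSegment s hmd x l)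

/-- The final hidden state `h_L` of the linear recurrence `h_t = A h_{t-1} + B x_t`, `h_0 = 0`,
driven by the inputs `x_1, …, x_L` (by recursion on the length of the input sequence). -/
def rnnState {r d : ℕ} (A : Matrix (Fin r) (Fin r) ℝ) (B : Matrix (Fin r) (Fin d) ℝ) :
    (L : ℕ) → (Fin L → Fin d → ℝ) → Fin r → ℝ
  | 0, _ => 0
  | L + 1, x => A *ᵥ rnnState A B L (fun t => x t.castSucc) + B *ᵥ x (Fin.last L)

/-- Linear recurrent network with output `1ᵀ h_L`; the parameter is the pair `(A, B)` of an `r × r`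
and an `r × d` matrix, given by their arrays of entries. -/
def netR (r : ℕ) {d L : ℕ} (x : Fin L → Fin d → ℝ)
    (θ : (Fin r → Fin r → ℝ) × (Fin r → Fin d → ℝ)) : ℝ :=
  ∑ i, rnnState (Matrix.of θ.1) (Matrix.of θ.2) L x i

end

noncomputable section

/-! Each network is linear in its input, and the Gaussian input law is isotropic, so the prediction
error is the Euclidean distance between coefficient vectors. If some slice of the parameter space is
mapped linearly and injectively to coefficient vectors, these contain a subspace `V`, and the risk
is at least that of Gaussian linear regression of dimension `p = dim V`, which is of order `√(σ² p /
n)`.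

The regression bound (`le_predRisk_of_submodule`) places a cube of side `σ / (4 √n)` along an
orthonormal basis of `V`. Adjacent vertices cannot be told apart from `n` samples
(`half_le_error_add_error`): the two laws differ by a likelihood ratio `exp g` with `E|g| ≤ 1/2`,
and `exp g ≥ 1 - |g|`. `assouad` adds this up over the `p` coordinates.

It remains to find large slices. For average pooling, all filters `w` will do. For weighted pooling,
freeze either `a` or `w` at a unit vector, giving dimension `m` or `K + 1`. For the recurrent
network, freeze `A` as a diagonal matrix with distinct entries; a Vandermonde argument makes `min r
L` rows of `B` identifiable. -/

theorem integral_sq_gaussianReal (v : ℝ≥0) : ∫ y, y ^ 2 ∂(gaussianReal 0 v) = v := by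
  rw [← variance_of_integral_eq_zero (X := fun y : ℝ => y) (by fun_prop)
    integral_id_gaussianReal, variance_fun_id_gaussianReal]

/-! ### Sums of independent centred variables. -/

section SumPi

variable {ι : Type*} [Fintype ι] {Ω : ι → Type*} [∀ i, MeasurableSpace (Ω i)]
  {ρ : ∀ i, Measure (Ω i)} [∀ i, IsProbabilityMeasure (ρ i)] {Y : ∀ i, Ω i → ℝ}

theorem memLp_sum_pi (hY : ∀ i, MemLp (Y i) 2 (ρ i)) :
    MemLp (fun ω : ∀ i, Ω i => ∑ i, Y i (ω i)) 2 (Measure.pi ρ) :=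
  memLp_finsetSum _ fun i _ => (hY i).comp_measurePreserving (measurePreserving_eval ρ i)

theorem integral_sum_pi_eq_zero (hY : ∀ i, MemLp (Y i) 2 (ρ i)) (h0 : ∀ i, ∫ a, Y i a ∂(ρ i) = 0) :
    ∫ ω : ∀ i, Ω i, ∑ i, Y i (ω i) ∂(Measure.pi ρ) = 0 := by
  have hint : ∀ i, Integrable (fun ω : ∀ i, Ω i => Y i (ω i)) (Measure.pi ρ) := fun i =>
    ((hY i).comp_measurePreserving (measurePreserving_eval ρ i)).integrable (by norm_num)
  rw [integral_finsetSum _ fun i _ => hint i]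
  refine Finset.sum_eq_zero fun i _ => ?_
  have hi := (hY i).aestronglyMeasurable
  have hmp := measurePreserving_eval ρ i
  rw [← hmp.map_eq] at hi
  have h := integral_map hmp.measurable.aemeasurable hi
  rw [hmp.map_eq, h0 i] at h
  exact h.symm

/-- The second moment of a sum of independent centred variables. -/
theorem integral_sq_sum_pi (hY : ∀ i, MemLp (Y i) 2 (ρ i)) (h0 : ∀ i, ∫ a, Y i a ∂(ρ i) = 0) :
    ∫ ω : ∀ i, Ω i, (∑ i, Y i (ω i)) ^ 2 ∂(Measure.pi ρ) = ∑ i, ∫ a, Y i a ^ 2 ∂(ρ i) := by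
  rw [← variance_of_integral_eq_zero (memLp_sum_pi hY).aemeasurable
    (integral_sum_pi_eq_zero hY h0)]
  have hs := variance_sum_pi hY
  rw [show (∑ i, fun ω : ∀ i, Ω i => Y i (ω i)) = fun ω => ∑ i, Y i (ω i) by
    funext ω; simp] at hs
  rw [hs]
  exact Finset.sum_congr rfl fun i _ =>
    variance_of_integral_eq_zero (hY i).aemeasurable (h0 i)

end SumPi

/-! ### Likelihood ratios for Gaussian noise. -/

/-- A finite power of a measure with density has the product density. -/
theorem pi_withDensity_const {ι α : Type*} [Fintype ι] [MeasurableSpace α] (ρ : Measure α)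
    [IsProbabilityMeasure ρ] {ℓ : α → ℝ≥0∞} (hℓ : Measurable ℓ)
    [SigmaFinite (ρ.withDensity ℓ)] :
    Measure.pi (fun _ : ι => ρ.withDensity ℓ) =
      (Measure.pi fun _ : ι => ρ).withDensity (fun z => ∏ i, ℓ (z i)) := by
  refine Measure.pi_eq fun s hs => ?_
  rw [withDensity_apply _ (MeasurableSet.univ_pi hs), ← lintegral_indicator (.univ_pi hs)]
  have hind : (Set.univ.pi s).indicator (fun z : ι → α => ∏ i, ℓ (z i)) =
      fun z => ∏ i, (s i).indicator ℓ (z i) := by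
    funext z
    by_cases hz : z ∈ Set.univ.pi s
    · rw [Set.indicator_of_mem hz]
      exact Finset.prod_congr rfl fun i _ => (Set.indicator_of_mem (hz i trivial) ℓ).symm
    · rw [Set.indicator_of_notMem hz]
      obtain ⟨i, hi⟩ : ∃ i, z i ∉ s i := by simpa [Set.mem_pi] using hz
      exact (Finset.prod_eq_zero (Finset.mem_univ i) (Set.indicator_of_notMem hi ℓ)).symm
  have hm : ∀ i, Measurable ((s i).indicator ℓ) := fun i => hℓ.indicator (hs i)
  rw [hind, lintegral_prod_eq_prod_lintegral_of_indepFun Finset.univ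
    (fun i (z : ι → α) => (s i).indicator ℓ (z i))
    (iIndepFun_pi (μ := fun _ : ι => ρ) fun i => (hm i).aemeasurable)
    fun i => (hm i).comp (measurable_pi_apply i)]
  refine Finset.prod_congr rfl fun i _ => ?_
  rw [withDensity_apply _ (hs i), ← lintegral_indicator (hs i),
    ← (measurePreserving_eval (fun _ : ι => ρ) i).lintegral_comp (hm i)]

/-- The log-likelihood ratio of `N(c, v)` with respect to `N(0, v)`. -/
def gaussLLR (v : ℝ≥0) (c y : ℝ) : ℝ := c * y / v - c ^ 2 / (2 * v)

theorem measurable_gaussLLR (v : ℝ≥0) {α : Type*} [MeasurableSpace α] {c y : α → ℝ}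
    (hc : Measurable c) (hy : Measurable y) : Measurable fun a => gaussLLR v (c a) (y a) := by
  unfold gaussLLR
  fun_prop

theorem measurable_likelihood (v : ℝ≥0) (c : ℝ) :
    Measurable fun y => ENNReal.ofReal (Real.exp (gaussLLR v c y)) :=
  (measurable_gaussLLR v measurable_const measurable_id).exp.ennreal_ofReal

theorem gaussianReal_eq_withDensity_gaussLLR (c : ℝ) {v : ℝ≥0} (hv : v ≠ 0) :
    gaussianReal c v =
      (gaussianReal 0 v).withDensity fun y => ENNReal.ofReal (Real.exp (gaussLLR v c y)) := by
  have hv' : (v : ℝ) ≠ 0 := by exact_mod_cast hv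
  rw [gaussianReal_of_var_ne_zero c hv, gaussianReal_of_var_ne_zero 0 hv,
    ← withDensity_mul _ (measurable_gaussianPDF 0 v) (measurable_likelihood v c)]
  congr 1
  funext y
  simp only [Pi.mul_apply, gaussianPDF]
  rw [← ENNReal.ofReal_mul (gaussianPDFReal_nonneg _ _ _)]
  congr 1
  rw [gaussianPDFReal, gaussianPDFReal, mul_assoc (√_)⁻¹, ← Real.exp_add]
  congr 2
  unfold gaussLLR
  field_simp
  ring

/-- Translating the noise by a function of the input amounts to reweighting by the likelihood
ratio. -/
theorem map_shift_prod_gaussianReal {X : Type*} [MeasurableSpace X] (μ : Measure X)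
    [IsProbabilityMeasure μ] {v : ℝ≥0} (hv : v ≠ 0) {h : X → ℝ} (hh : Measurable h) :
    (μ.prod (gaussianReal 0 v)).map (fun z => (z.1, h z.1 + z.2)) =
      (μ.prod (gaussianReal 0 v)).withDensity
        fun z => ENNReal.ofReal (Real.exp (gaussLLR v (h z.1) z.2)) := by
  have hT : Measurable fun z : X × ℝ => (z.1, h z.1 + z.2) := by fun_prop
  have hD : Measurable fun z : X × ℝ => ENNReal.ofReal (Real.exp (gaussLLR v (h z.1) z.2)) :=
    (measurable_gaussLLR v (hh.comp measurable_fst) measurable_snd).exp.ennreal_ofReal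
  refine Measure.ext_of_lintegral _ fun f hf => ?_
  rw [lintegral_map hf hT, lintegral_withDensity_eq_lintegral_mul _ hD hf,
    lintegral_prod (fun z : X × ℝ => f (z.1, h z.1 + z.2)) (hf.comp hT).aemeasurable,
    lintegral_prod _ (hD.mul hf).aemeasurable]
  -- For a fixed input `x` this is the translation of `N(0, v)` by the constant `h x`.
  refine lintegral_congr fun x => ?_
  have hfx : Measurable fun y => f (x, y) := hf.comp measurable_prodMk_left
  have h1 := gaussianReal_map_const_add (μ := 0) (v := v) (h x)
  rw [zero_add, gaussianReal_eq_withDensity_gaussLLR (h x) hv] at h1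
  have h2 := congrArg (fun m => ∫⁻ y, f (x, y) ∂m) h1
  rw [lintegral_map hfx (measurable_const_add (h x)),
    lintegral_withDensity_eq_lintegral_mul _ (measurable_likelihood v (h x)) hfx] at h2
  exact h2

/-- The two error probabilities of a test add up to at least `1` minus the first absolute moment of
the log-likelihood ratio. -/
theorem one_le_lintegral_add_lintegral_add {Z W : Type*} [MeasurableSpace Z] [MeasurableSpace W]
    (M : Measure Z) [IsProbabilityMeasure M] {S S' : Z → W} (hS : Measurable S)
    {g : Z → ℝ} (hg : Measurable g)
    (hmap : M.map S' = (M.withDensity fun z => ENNReal.ofReal (Real.exp (g z))).map S)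
    {φ ψ : W → ℝ≥0∞} (hφ : Measurable φ) (hψ : Measurable ψ) (hφψ : ∀ w, φ w + ψ w = 1) :
    1 ≤ ∫⁻ w, φ w ∂(M.map S) + ∫⁻ w, ψ w ∂(M.map S') + ∫⁻ z, ENNReal.ofReal |g z| ∂M := by
  have he : Measurable fun z => ENNReal.ofReal (Real.exp (g z)) := hg.exp.ennreal_ofReal
  have hφS : Measurable fun z => φ (S z) := hφ.comp hS
  have hψS : Measurable fun z => ψ (S z) := hψ.comp hS
  rw [hmap, lintegral_map hφ hS, lintegral_map hψ hS,
    lintegral_withDensity_eq_lintegral_mul _ he hψS, ← lintegral_add_left hφS,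
    ← lintegral_add_right _ hg.abs.ennreal_ofReal]
  have h1 : (1 : ℝ≥0∞) = ∫⁻ _, 1 ∂M := by simp
  refine h1.le.trans (lintegral_mono fun z => ?_)
  simp only [Pi.mul_apply]
  -- From `exp g ≥ 1 + g ≥ 1 - |g|`; no divergence between measures is needed.
  have hb : 1 ≤ ENNReal.ofReal (Real.exp (g z)) + ENNReal.ofReal |g z| := by
    rw [← ENNReal.ofReal_add (Real.exp_pos _).le (abs_nonneg _), ENNReal.one_le_ofReal]
    linarith [Real.add_one_le_exp (g z), neg_abs_le (g z)]
  have hψ1 : ψ (S z) ≤ 1 := (hφψ (S z)) ▸ le_add_self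
  calc (1 : ℝ≥0∞) = φ (S z) + ψ (S z) * 1 := by rw [mul_one, hφψ]
    _ ≤ φ (S z) + ψ (S z) * (ENNReal.ofReal (Real.exp (g z)) + ENNReal.ofReal |g z|) := by
        gcongr
    _ ≤ φ (S z) + (ENNReal.ofReal (Real.exp (g z)) * ψ (S z) + 1 * ENNReal.ofReal |g z|) := by
        rw [mul_add, mul_comm (ψ (S z))]
        gcongr
    _ = _ := by rw [one_mul, add_assoc]

/-- The log-likelihood ratio of an `n`-sample has first absolute moment at most `1 / 2` when the
regression functions are at squared distance at most `v / (16 n)`. -/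
theorem lintegral_abs_sum_gaussLLR_le {X : Type*} [MeasurableSpace X] (μ : Measure X)
    [IsProbabilityMeasure μ] {v : ℝ≥0} (hv : v ≠ 0) {h : X → ℝ} (hh : Measurable h)
    (hh2 : MemLp h 2 μ) {n : ℕ} (hn : n * ∫ x, h x ^ 2 ∂μ ≤ v / 16) :
    ∫⁻ z, ENNReal.ofReal |∑ i : Fin n, gaussLLR v (h (z i).1) (z i).2|
      ∂(Measure.pi fun _ : Fin n => μ.prod (gaussianReal 0 v)) ≤ ENNReal.ofReal (1 / 2) := by
  have hv0 : (0 : ℝ) < v := by exact_mod_cast pos_iff_ne_zero.2 hv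
  set ν := gaussianReal 0 v
  set M := Measure.pi fun _ : Fin n => μ.prod ν
  have hsqν : ∫ y, y ^ 2 ∂ν = v := integral_sq_gaussianReal v
  have hint : Integrable (fun x => h x ^ 2) μ := hh2.integrable_sq
  have hintν : Integrable (fun y : ℝ => y ^ 2) ν := (memLp_id_gaussianReal 2).integrable_sq
  let ζ : X × ℝ → ℝ := fun p => h p.1 * p.2
  have hζm : Measurable ζ := by fun_prop
  have hζsq : ∀ p, ζ p ^ 2 = h p.1 ^ 2 * p.2 ^ 2 := fun p => mul_pow _ _ _
  have hζ2 : MemLp ζ 2 (μ.prod ν) := by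
    rw [memLp_two_iff_integrable_sq hζm.aestronglyMeasurable]
    simp_rw [hζsq]
    exact hint.mul_prod hintν
  have hζ0 : ∫ p, ζ p ∂(μ.prod ν) = 0 := by
    change ∫ p, h p.1 * p.2 ∂(μ.prod ν) = 0
    rw [integral_prod_mul h (fun y : ℝ => y), show ∫ y, y ∂ν = 0 from integral_id_gaussianReal,
      mul_zero]
  have hmp : ∀ i : Fin n, MeasurePreserving (fun z : Fin n → X × ℝ => z i) M (μ.prod ν) :=
    fun i => measurePreserving_eval (fun _ : Fin n => μ.prod ν) i
  let Z : (Fin n → X × ℝ) → ℝ := fun z => ∑ i, ζ (z i)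
  have hZ2 : MemLp Z 2 M := memLp_sum_pi fun _ => hζ2
  have hZsq : ∫ z, Z z ^ 2 ∂M = n * (∫ x, h x ^ 2 ∂μ) * v := by
    rw [integral_sq_sum_pi (fun _ => hζ2) fun _ => hζ0]
    simp_rw [hζsq]
    rw [integral_prod_mul (fun x => h x ^ 2) (fun y : ℝ => y ^ 2), hsqν]
    simp [mul_assoc]
  have hhi : ∀ i : Fin n, Integrable (fun z : Fin n → X × ℝ => h (z i).1 ^ 2) M := fun i =>
    (hmp i).integrable_comp_of_integrable (g := fun p : X × ℝ => h p.1 ^ 2) (hint.comp_fst ν)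
  have hhs : ∫ z, ∑ i, h (z i).1 ^ 2 ∂M = n * ∫ x, h x ^ 2 ∂μ := by
    rw [integral_finsetSum _ fun i _ => hhi i]
    have : ∀ i : Fin n, ∫ z, h (z i).1 ^ 2 ∂M = ∫ x, h x ^ 2 ∂μ := by
      intro i
      have h1 := integral_map (μ := M) (hmp i).measurable.aemeasurable
          (f := fun p : X × ℝ => h p.1 ^ 2)
        ((hh.comp measurable_fst).pow_const 2).aestronglyMeasurable
      rw [← h1, (hmp i).map_eq, integral_fun_fst (fun x => h x ^ 2)]
      simp
    simp [this]
  -- The log-likelihood ratio is `Z / v - ∑ h² / (2v)`, and `|t| ≤ 2 t² + 1/8` replaces `|Z / v|` by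
  -- a second moment. The expectation of `G` is at most `1/8 + 1/8 + 1/32 < 1/2`.
  let G : (Fin n → X × ℝ) → ℝ := fun z =>
    2 / v ^ 2 * Z z ^ 2 + 1 / 8 + 1 / (2 * v) * ∑ i, h (z i).1 ^ 2
  have hG0 : ∀ z, 0 ≤ G z := fun z => by positivity
  have hi1 : Integrable (fun z => 2 / (v : ℝ) ^ 2 * Z z ^ 2 + 1 / 8) M :=
    (hZ2.integrable_sq.const_mul _).add (integrable_const _)
  have hi2 : Integrable (fun z : Fin n → X × ℝ => 1 / (2 * (v : ℝ)) * ∑ i, h (z i).1 ^ 2) M :=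
    (integrable_finsetSum _ fun i _ => hhi i).const_mul _
  have hGint : Integrable G M := hi1.add hi2
  have hGval : ∫ z, G z ∂M ≤ 1 / 2 := by
    change ∫ z, (2 / (v : ℝ) ^ 2 * Z z ^ 2 + 1 / 8) +
      1 / (2 * (v : ℝ)) * ∑ i, h (z i).1 ^ 2 ∂M ≤ 1 / 2
    rw [integral_add hi1 hi2, integral_add (hZ2.integrable_sq.const_mul _) (integrable_const _),
      integral_const_mul, integral_const_mul, hZsq, hhs, integral_const]
    set a := n * ∫ x, h x ^ 2 ∂μ
    have e1 : 2 / (v : ℝ) ^ 2 * (a * v) = 2 * (a / v) := by field_simp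
    have e2 : 1 / (2 * (v : ℝ)) * a = (a / v) / 2 := by field_simp
    have e3 : a / v ≤ 1 / 16 := by
      rw [div_le_iff₀ hv0]
      linarith
    rw [e1, e2]
    simp
    linarith
  calc _ ≤ ∫⁻ z, ENNReal.ofReal (G z) ∂M := by
        refine lintegral_mono fun z => ENNReal.ofReal_le_ofReal ?_
        have hsum : ∑ i : Fin n, gaussLLR v (h (z i).1) (z i).2 =
            Z z / v - 1 / (2 * v) * ∑ i, h (z i).1 ^ 2 := by
          simp only [gaussLLR, Z, ζ, Finset.sum_sub_distrib, Finset.sum_div, Finset.mul_sum]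
          congr 1
          exact Finset.sum_congr rfl fun i _ => by ring
        rw [hsum]
        have hpos : 0 ≤ 1 / (2 * (v : ℝ)) * ∑ i, h (z i).1 ^ 2 := by positivity
        have hsq : 2 / (v : ℝ) ^ 2 * Z z ^ 2 = 2 * (Z z / v) ^ 2 := by ring
        simp only [G]
        rw [hsq, abs_le]
        constructor <;> nlinarith [sq_nonneg (Z z / v - 1 / 4), sq_nonneg (Z z / v + 1 / 4)]
    _ = ENNReal.ofReal (∫ z, G z ∂M) :=
        (ofReal_integral_eq_lintegral_ofReal hGint (.of_forall hG0)).symm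
    _ ≤ _ := ENNReal.ofReal_le_ofReal hGval

/-! ### Testing two parameters, and Assouad's lemma. -/

theorem measurable_labelledSample {X Θ : Type*} [MeasurableSpace X] [MeasurableSpace Θ]
    {F : X → Θ → ℝ} (hF : Measurable fun p : X × Θ => F p.1 p.2) (n : ℕ) :
    Measurable (labelledSample F n) := by
  refine measurable_pi_lambda _ fun i => ?_
  have h1 : Measurable fun p : Θ × (Fin n → X × ℝ) => (p.2 i).1 := by fun_prop
  have h2 : Measurable fun p : Θ × (Fin n → X × ℝ) => (p.2 i).2 := by fun_prop
  exact h1.prodMk ((hF.comp (h1.prodMk measurable_fst)).add h2)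

theorem dataLaw_apply {X Θ : Type*} [MeasurableSpace X] [MeasurableSpace Θ]
    {F : X → Θ → ℝ} (hF : Measurable fun p : X × Θ => F p.1 p.2) (μ : Measure X)
    [IsProbabilityMeasure μ] (ν : Measure ℝ) [IsProbabilityMeasure ν] (n : ℕ) (θ : Θ) :
    dataLaw F μ ν n θ =
      (Measure.pi fun _ : Fin n => μ.prod ν).map fun z => labelledSample F n (θ, z) := by
  have hm := measurable_labelledSample hF n
  rw [dataLaw, Kernel.map_apply _ hm, Kernel.prod_apply, Kernel.id_apply, Kernel.const_apply,
    Measure.dirac_prod, Measure.map_map hm measurable_prodMk_left]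
  rfl

/-- Two regression functions at squared distance at most `v / (16 n)` cannot be told apart with
small error probabilities. -/
theorem half_le_error_add_error {X Θ : Type*} [MeasurableSpace X] [MeasurableSpace Θ]
    {F : X → Θ → ℝ} (hF : Measurable fun p : X × Θ => F p.1 p.2) (μ : Measure X)
    [IsProbabilityMeasure μ] {v : ℝ≥0} (hv : v ≠ 0) {n : ℕ} {θ θ' : Θ}
    (h2 : MemLp (fun x => F x θ' - F x θ) 2 μ)
    (hn : n * ∫ x, (F x θ' - F x θ) ^ 2 ∂μ ≤ v / 16)
    (κ : Kernel (Fin n → X × ℝ) Θ) [IsMarkovKernel κ] {E : Set Θ} (hE : MeasurableSet E) :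
    ENNReal.ofReal (1 / 2) ≤ (κ ∘ₖ dataLaw F μ (gaussianReal 0 v) n) θ E +
      (κ ∘ₖ dataLaw F μ (gaussianReal 0 v) n) θ' Eᶜ := by
  set ν := gaussianReal 0 v
  set M := Measure.pi fun _ : Fin n => μ.prod ν
  have hFθ : ∀ θ, Measurable fun x => F x θ := fun θ => hF.comp measurable_prodMk_right
  set h : X → ℝ := fun x => F x θ' - F x θ
  have hh : Measurable h := (hFθ θ').sub (hFθ θ)
  have hS : ∀ θ, Measurable fun z => labelledSample F n (θ, z) := fun θ =>
    (measurable_labelledSample hF n).comp measurable_prodMk_left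
  -- The sample under `θ'` is the sample under `θ` with the noise translated by `h`, so both laws
  -- are images of `M` and of a reweighting of `M` under one map.
  let τ : X × ℝ → X × ℝ := fun p => (p.1, h p.1 + p.2)
  have hτ : Measurable τ := by fun_prop
  have hT : Measurable fun (z : Fin n → X × ℝ) i => τ (z i) := by fun_prop
  let g : (Fin n → X × ℝ) → ℝ := fun z => ∑ i, gaussLLR v (h (z i).1) (z i).2
  have hg : Measurable g := Finset.measurable_sum _ fun i _ =>
    measurable_gaussLLR v (hh.comp (measurable_fst.comp (measurable_pi_apply i)))
      (measurable_snd.comp (measurable_pi_apply i))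
  have hMT : M.map (fun z i => τ (z i)) =
      M.withDensity fun z => ENNReal.ofReal (Real.exp (g z)) := by
    have hpr : IsProbabilityMeasure ((μ.prod ν).map τ) :=
      Measure.isProbabilityMeasure_map hτ.aemeasurable
    have hmap := map_shift_prod_gaussianReal μ hv hh
    have hsf : SigmaFinite ((μ.prod ν).withDensity
        fun z => ENNReal.ofReal (Real.exp (gaussLLR v (h z.1) z.2))) := by
      rw [← hmap]
      exact inferInstanceAs (SigmaFinite ((μ.prod ν).map τ))
    rw [Measure.pi_map_pi (f := fun _ : Fin n => τ) fun _ => hτ.aemeasurable]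
    simp_rw [show (μ.prod ν).map τ = _ from hmap]
    rw [pi_withDensity_const (μ.prod ν)
      (ℓ := fun z => ENNReal.ofReal (Real.exp (gaussLLR v (h z.1) z.2)))
      (measurable_gaussLLR v (hh.comp measurable_fst) measurable_snd).exp.ennreal_ofReal]
    congr 1
    funext z
    rw [Real.exp_sum, ENNReal.ofReal_prod_of_nonneg fun i _ => (Real.exp_pos _).le]
  have hmap : M.map (fun z => labelledSample F n (θ', z)) =
      (M.withDensity fun z => ENNReal.ofReal (Real.exp (g z))).map
        fun z => labelledSample F n (θ, z) := by
    rw [← hMT, Measure.map_map (hS θ) hT]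
    congr 1
    funext z i
    simp only [labelledSample, Function.comp_apply, τ, h, Prod.mk.injEq, true_and]
    ring
  -- The randomized test accepts with probability `κ w E`, so kernels are treated like deterministic
  -- estimators.
  have key := one_le_lintegral_add_lintegral_add M (hS θ) hg hmap
    (κ.measurable_coe hE) (κ.measurable_coe hE.compl) fun w => by
      rw [measure_add_measure_compl hE, measure_univ]
  have hle := key.trans (add_le_add_right (lintegral_abs_sum_gaussLLR_le μ hv hh h2 hn) _)
  rw [Kernel.comp_apply' _ _ _ hE, Kernel.comp_apply' _ _ _ hE.compl, dataLaw_apply hF,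
    dataLaw_apply hF]
  have h12 : (1 : ℝ≥0∞) = ENNReal.ofReal (1 / 2) + ENNReal.ofReal (1 / 2) := by
    rw [← ENNReal.ofReal_add (by norm_num) (by norm_num)]
    norm_num
  rw [h12] at hle
  exact (ENNReal.add_le_add_iff_right ENNReal.ofReal_ne_top).1 hle

/-- **Assouad's lemma** for a family of laws of estimates indexed by the vertices of a cube. -/
theorem assouad {Θ : Type*} [MeasurableSpace Θ] {p : ℕ} {Q : (Fin p → Bool) → Measure Θ}
    (hQ : ∀ v j, ∀ E, MeasurableSet E →
      ENNReal.ofReal (1 / 2) ≤ Q v E + Q (Function.update v j !(v j)) Eᶜ)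
    {B : Fin p → Set Θ} (hB : ∀ j, MeasurableSet (B j)) {k R : ℝ≥0∞}
    {loss : (Fin p → Bool) → Θ → ℝ≥0∞}
    (hloss : ∀ v y, k * ∑ j, (if v j then (B j)ᶜ else B j).indicator 1 y ≤ loss v y)
    (hR : ∀ v, ∫⁻ y, loss v y ∂(Q v) ≤ R) :
    k * (p * ENNReal.ofReal (1 / 4)) ≤ R := by
  -- `E v j` is the event that bit `j`, decoded by membership in `B j`, differs from `v j`.
  let E : (Fin p → Bool) → Fin p → Set Θ := fun v j => if v j then (B j)ᶜ else B j
  have hE : ∀ v j, MeasurableSet (E v j) := fun v j => by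
    simp only [E]
    split_ifs
    exacts [(hB j).compl, hB j]
  set N : ℝ≥0∞ := ((Fintype.card (Fin p → Bool) : ℕ) : ℝ≥0∞)
  have hN0 : N ≠ 0 := by simp [N]
  have hNt : N ≠ ∞ := ENNReal.natCast_ne_top _
  have hv : ∀ v, k * ∑ j, Q v (E v j) ≤ R := fun v => by
    refine le_trans (le_of_eq ?_) ((lintegral_mono (hloss v)).trans (hR v))
    have hm : ∀ j, Measurable ((E v j).indicator (1 : Θ → ℝ≥0∞)) := fun j =>
      measurable_one.indicator (hE v j)
    rw [lintegral_const_mul _ (Finset.measurable_sum _ fun j _ => hm j),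
      lintegral_finsetSum _ fun j _ => hm j]
    congr 1
    exact Finset.sum_congr rfl fun j _ => (lintegral_indicator_one (hE v j)).symm
  have hj : ∀ j, N * ENNReal.ofReal (1 / 4) ≤ ∑ v, Q v (E v j) := fun j => by
    -- Flipping bit `j` pairs the vertices and turns the error event into its complement, so the two
    -- error probabilities of each pair are those of a single test.
    let flip : (Fin p → Bool) → (Fin p → Bool) := fun v => Function.update v j !(v j)
    have hflip : Function.Involutive flip := fun v => by simp [flip]
    have h1 : ∑ v, Q (flip v) (E (flip v) j) = ∑ v, Q v (E v j) :=
      Equiv.sum_comp hflip.toPerm fun v => Q v (E v j)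
    have h2 : N * ENNReal.ofReal (1 / 2) ≤ ∑ v, (Q v (E v j) + Q (flip v) (E (flip v) j)) := by
      have : N * ENNReal.ofReal (1 / 2) = ∑ _v : Fin p → Bool, ENNReal.ofReal (1 / 2) := by
        rw [Finset.sum_const, Finset.card_univ, nsmul_eq_mul]
      rw [this]
      refine Finset.sum_le_sum fun v _ => ?_
      have hc : E (flip v) j = (E v j)ᶜ := by
        by_cases h : v j <;> simp [E, flip, h]
      rw [hc]
      exact hQ v j _ (hE v j)
    rw [Finset.sum_add_distrib, h1, ← two_mul] at h2
    have h3 : N * ENNReal.ofReal (1 / 2) = 2 * (N * ENNReal.ofReal (1 / 4)) := by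
      rw [show (1 / 2 : ℝ) = 2 * (1 / 4) by norm_num, ENNReal.ofReal_mul (by norm_num)]
      simp only [ENNReal.ofReal_ofNat]
      ring
    rw [h3] at h2
    exact (ENNReal.mul_le_mul_iff_right (by norm_num) (by norm_num)).1 h2
  refine (ENNReal.mul_le_mul_iff_right hN0 hNt).1 ?_
  calc N * (k * (p * ENNReal.ofReal (1 / 4)))
      = k * ∑ _j : Fin p, N * ENNReal.ofReal (1 / 4) := by
        rw [Finset.sum_const, Finset.card_univ, Fintype.card_fin, nsmul_eq_mul]
        ring
    _ ≤ k * ∑ j, ∑ v, Q v (E v j) := by gcongr with j; exact hj j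
    _ = ∑ v, k * ∑ j, Q v (E v j) := by rw [Finset.sum_comm, Finset.mul_sum]
    _ ≤ ∑ _v : Fin p → Bool, R := Finset.sum_le_sum fun v _ => hv v
    _ = N * R := by rw [Finset.sum_const, Finset.card_univ, nsmul_eq_mul]

/-! ### Models linear in orthonormal features. -/

section LinearModel

variable {X Θ ι : Type*} [Fintype ι] [MeasurableSpace X]

/-- Isotropy turns the loss into a Euclidean norm, on which orthonormal coordinates can act. -/
theorem predErr_eq_norm {μ : Measure X} {f : ι → X → ℝ} (hf2 : ∀ i, MemLp (f i) 2 μ)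
    (hiso : ∀ a : ι → ℝ, ∫ x, (∑ i, a i * f i x) ^ 2 ∂μ = ∑ i, a i ^ 2)
    {F : X → Θ → ℝ} {c : Θ → ι → ℝ} (hF : ∀ x θ, F x θ = ∑ i, c θ i * f i x) (θ θ' : Θ) :
    predErr F μ θ θ' = ENNReal.ofReal ‖WithLp.toLp 2 (c θ) - WithLp.toLp 2 (c θ')‖ := by
  have hd : ∀ x, F x θ - F x θ' = ∑ i, (c θ i - c θ' i) * f i x := fun x => by
    rw [hF, hF, ← Finset.sum_sub_distrib]
    exact Finset.sum_congr rfl fun i _ => by ring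
  have hm : MemLp (fun x => ∑ i, (c θ i - c θ' i) * f i x) 2 μ :=
    memLp_finsetSum _ fun i _ => (hf2 i).const_mul _
  have hsq : ∀ x, ‖F x θ - F x θ'‖ₑ ^ 2 =
      ENNReal.ofReal ((∑ i, (c θ i - c θ' i) * f i x) ^ 2) := fun x => by
    rw [hd, Real.enorm_eq_ofReal_abs, ← ENNReal.ofReal_pow (abs_nonneg _), sq_abs]
  rw [predErr]
  simp_rw [hsq]
  rw [← ofReal_integral_eq_lintegral_ofReal hm.integrable_sq (.of_forall fun x => sq_nonneg _),
    hiso, ENNReal.ofReal_rpow_of_nonneg (Finset.sum_nonneg fun i _ => sq_nonneg _) (by norm_num),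
    ← Real.sqrt_eq_rpow, EuclideanSpace.norm_eq]
  simp

/-- Rounding the coordinates of `u` in an orthonormal family costs at most `2 / δ` times the
distance in the sense of Assouad's lemma. -/
theorem sum_ite_le_norm {E : Type*} [NormedAddCommGroup E] [InnerProductSpace ℝ E] {p : ℕ}
    {e : Fin p → E} (he : Orthonormal ℝ e) (u w : E) {δ : ℝ} (P : Fin p → Prop)
    [DecidablePred P] (hP : ∀ j, P j → δ / 2 ≤ |inner ℝ (e j) (u - w)|) :
    δ / 2 * ∑ j, (if P j then (1 : ℝ) else 0) ≤ √p * ‖u - w‖ := by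
  have h1 : δ / 2 * ∑ j, (if P j then (1 : ℝ) else 0) ≤ ∑ j, |inner ℝ (e j) (u - w)| := by
    rw [Finset.mul_sum]
    refine Finset.sum_le_sum fun j _ => ?_
    split_ifs with h
    · simpa using hP j h
    · simp
  -- Cauchy–Schwarz, then Bessel. Since Bessel suffices, `u - w` may lie outside the span of the
  -- family: the estimate need not stay in the chosen slice.
  have h2 : (∑ j, |inner ℝ (e j) (u - w)|) ^ 2 ≤ p * ‖u - w‖ ^ 2 := by
    refine sq_sum_le_card_mul_sum_sq.trans ?_
    rw [Finset.card_univ, Fintype.card_fin]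
    gcongr
    simpa using he.sum_inner_products_le (u - w) (s := Finset.univ)
  refine h1.trans (abs_le_of_sq_le_sq' ?_ (by positivity)).2
  rwa [mul_pow, Real.sq_sqrt (Nat.cast_nonneg p)]

/-- The minimax risk of a model that is linear in orthonormal features, and whose coefficient
vectors fill a subspace `V`, is at least of the order of the parametric rate `√(σ² dim V / n)`. -/
theorem le_predRisk_of_submodule [MeasurableSpace Θ] {μ : Measure X} [IsProbabilityMeasure μ]
    {f : ι → X → ℝ} (hf : ∀ i, Measurable (f i)) (hf2 : ∀ i, MemLp (f i) 2 μ)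
    (hiso : ∀ a : ι → ℝ, ∫ x, (∑ i, a i * f i x) ^ 2 ∂μ = ∑ i, a i ^ 2)
    {F : X → Θ → ℝ} {c : Θ → ι → ℝ} (hc : Measurable c)
    (hF : ∀ x θ, F x θ = ∑ i, c θ i * f i x) (V : Submodule ℝ (EuclideanSpace ℝ ι))
    (hV : ∀ v ∈ V, ∃ θ, WithLp.toLp 2 (c θ) = v) {n : ℕ} (hn : 0 < n) (σ : ℝ≥0) :
    ENNReal.ofReal (1 / 32 * √((σ : ℝ) ^ 2 * Module.finrank ℝ V / n)) ≤
      predRisk F μ (gaussianReal 0 (σ ^ 2)) n := by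
  set p := Module.finrank ℝ V
  -- Without noise there is no Gaussian density, but the bound is then zero.
  rcases eq_or_ne σ 0 with rfl | hσ
  · simp
  rcases Nat.eq_zero_or_pos p with hp | hp
  · simp [hp]
  have hσ0 : (0 : ℝ) < σ := by exact_mod_cast pos_iff_ne_zero.2 hσ
  have hn0 : (0 : ℝ) < n := by exact_mod_cast hn
  have hp0 : (0 : ℝ) < p := by exact_mod_cast hp
  have hFm : Measurable fun q : X × Θ => F q.1 q.2 := by
    simp_rw [hF]
    refine Finset.measurable_sum _ fun i _ => ?_
    exact ((measurable_pi_apply i).comp (hc.comp measurable_snd)).mul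
      ((hf i).comp measurable_fst)
  let e : Fin p → EuclideanSpace ℝ ι := fun j => (stdOrthonormalBasis ℝ V j : EuclideanSpace ℝ ι)
  have he : Orthonormal ℝ e :=
    (stdOrthonormalBasis ℝ V).orthonormal.comp_linearIsometry V.subtypeₗᵢ
  -- Chosen so that `n δ² = σ² / 16`, exactly the threshold for indistinguishable neighbours.
  set δ : ℝ := σ / (4 * √n)
  have hδ : 0 < δ := by positivity
  let a : (Fin p → Bool) → Fin p → ℝ := fun v j => if v j then δ else 0
  have hex : ∀ v, ∃ θ, WithLp.toLp 2 (c θ) = ∑ j, a v j • e j := fun v =>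
    hV _ (Submodule.sum_mem _ fun j _ => V.smul_mem _ (Subtype.coe_prop _))
  choose θ hθ using hex
  have hcoord : ∀ v j, inner ℝ (e j) (WithLp.toLp 2 (c (θ v))) = a v j := fun v j => by
    rw [hθ]
    exact he.inner_right_fintype _ _
  refine le_iInf₂ fun κ hκ => ?_
  -- Decoding thresholds each coordinate at the midpoint of `0` and `δ`, so a wrong bit costs at
  -- least `δ / 2` in that coordinate.
  let B : Fin p → Set Θ := fun j => {y | δ / 2 < inner ℝ (e j) (WithLp.toLp 2 (c y))}
  have hB : ∀ j, MeasurableSet (B j) := fun j => by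
    refine measurableSet_lt measurable_const ?_
    have h1 : Continuous fun u : ι → ℝ => inner ℝ (e j) (WithLp.toLp 2 u) := by fun_prop
    exact h1.measurable.comp hc
  have key := assouad (Q := fun v => (κ ∘ₖ dataLaw F μ (gaussianReal 0 (σ ^ 2)) n) (θ v))
    (k := ENNReal.ofReal (δ / (2 * √p))) (loss := fun v y => predErr F μ (θ v) y)
    (R := ⨆ t, ∫⁻ y, predErr F μ t y ∂((κ ∘ₖ dataLaw F μ (gaussianReal 0 (σ ^ 2)) n) t))
    ?_ hB ?_ fun v => le_iSup
      (fun t => ∫⁻ y, predErr F μ t y ∂((κ ∘ₖ dataLaw F μ (gaussianReal 0 (σ ^ 2)) n) t)) (θ v)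
  -- The constant: `δ / (2 √p) * (p / 4) = σ √p / (32 √n)`.
  · refine le_trans (le_of_eq ?_) key
    rw [← ENNReal.ofReal_natCast p, ← ENNReal.ofReal_mul hp0.le,
      ← ENNReal.ofReal_mul (by positivity)]
    congr 1
    rw [Real.sqrt_div (by positivity), Real.sqrt_mul (by positivity), Real.sqrt_sq hσ0.le]
    have hpp : (p : ℝ) = √p * √p := (Real.mul_self_sqrt hp0.le).symm
    have : √(p : ℝ) ≠ 0 := by positivity
    simp only [δ]
    field_simp
    rw [Real.sq_sqrt hp0.le]
    ring
  · intro v j E hE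
    set w := Function.update v j !(v j)
    have hd : ∀ x, F x (θ w) - F x (θ v) = ∑ i, (c (θ w) i - c (θ v) i) * f i x := fun x => by
      rw [hF, hF, ← Finset.sum_sub_distrib]
      exact Finset.sum_congr rfl fun i _ => by ring
    have hnorm : ‖WithLp.toLp 2 (c (θ w)) - WithLp.toLp 2 (c (θ v))‖ = δ := by
      rw [hθ, hθ, ← Finset.sum_sub_distrib, Finset.sum_eq_single j]
      · rw [← sub_smul, norm_smul, he.norm_eq_one, mul_one]
        by_cases h : v j <;> simp [a, w, h, abs_of_pos hδ]
      · intro i _ hij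
        simp [a, w, hij]
      · simp
    refine half_le_error_add_error hFm μ (pow_ne_zero 2 hσ) ?_ ?_ κ hE
    · simp_rw [hd]
      exact memLp_finsetSum _ fun i _ => (hf2 i).const_mul _
    · simp_rw [hd]
      rw [hiso]
      have h1 : ∑ i, (c (θ w) i - c (θ v) i) ^ 2 = δ ^ 2 := by
        rw [← hnorm, EuclideanSpace.norm_sq_eq]
        simp
      rw [h1]
      simp only [δ, div_pow, mul_pow, Real.sq_sqrt hn0.le]
      push_cast
      apply le_of_eq
      field_simp
      norm_num
  · intro v y
    classical
    rw [predErr_eq_norm hf2 hiso hF]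
    let P : Fin p → Prop := fun j => y ∈ (if v j then (B j)ᶜ else B j)
    have hsum : ∑ j, (if v j then (B j)ᶜ else B j).indicator (1 : Θ → ℝ≥0∞) y =
        ENNReal.ofReal (∑ j, if P j then (1 : ℝ) else 0) := by
      rw [ENNReal.ofReal_sum_of_nonneg fun j _ => by split_ifs <;> norm_num]
      refine Finset.sum_congr rfl fun j _ => ?_
      by_cases h : P j
      · rw [Set.indicator_of_mem h, if_pos h]
        simp
      · rw [Set.indicator_of_notMem h, if_neg h]
        simp
    rw [hsum, ← ENNReal.ofReal_mul (by positivity)]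
    refine ENNReal.ofReal_le_ofReal ?_
    have h := sum_ite_le_norm he (WithLp.toLp 2 (c (θ v))) (WithLp.toLp 2 (c y)) (δ := δ) P
      fun j hj => by
        rw [inner_sub_right, hcoord]
        simp only [P, B, a] at hj ⊢
        by_cases hvj : v j
        · simp only [hvj, if_true, Set.mem_compl_iff, Set.mem_ofPred_eq, not_lt] at hj ⊢
          exact le_trans (by linarith) (le_abs_self _)
        · simp only [hvj, Bool.false_eq_true, if_false, Set.mem_ofPred_eq] at hj ⊢
          exact le_trans (by linarith) (neg_le_abs _)
    have hs : 0 < √(p : ℝ) := by positivity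
    rw [div_mul_eq_mul_div, div_le_iff₀ (by positivity)]
    nlinarith

/-- The case in which the model is linear in the input, whose coordinates in some basis are
orthonormal. -/
theorem le_predRisk_of_injective [MeasurableSpace Θ] [AddCommGroup X] [Module ℝ X]
    {μ : Measure X} [IsProbabilityMeasure μ] (b : Module.Basis ι ℝ X)
    (hb : ∀ i, Measurable fun x => b.repr x i)
    (hb2 : ∀ i, MemLp (fun x => b.repr x i) 2 μ)
    (hiso : ∀ a : ι → ℝ, ∫ x, (∑ i, a i * b.repr x i) ^ 2 ∂μ = ∑ i, a i ^ 2)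
    {F : X → Θ → ℝ} (hFx : ∀ θ, IsLinearMap ℝ fun x => F x θ) (hFθ : ∀ x, Measurable (F x))
    {G : Type*} [AddCommGroup G] [Module ℝ G] [Module.Finite ℝ G] (φ : G → Θ)
    (hφ : ∀ x, IsLinearMap ℝ fun g => F x (φ g))
    (hinj : ∀ g, (∀ x, F x (φ g) = 0) → g = 0)
    {n : ℕ} (hn : 0 < n) (σ : ℝ≥0) :
    ENNReal.ofReal (1 / 32 * √((σ : ℝ) ^ 2 * Module.finrank ℝ G / n)) ≤
      predRisk F μ (gaussianReal 0 (σ ^ 2)) n := by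
  let c : Θ → ι → ℝ := fun θ i => F (b i) θ
  have hF : ∀ x θ, F x θ = ∑ i, c θ i * b.repr x i := fun x θ => by
    have h := congrArg (IsLinearMap.mk' _ (hFx θ)) (b.sum_repr x)
    rw [map_sum] at h
    simp only [map_smul, IsLinearMap.mk'_apply, smul_eq_mul] at h
    rw [← h]
    exact Finset.sum_congr rfl fun i _ => mul_comm _ _
  -- Only the composite of `φ` with the coefficient map is linear; `φ` itself may be affine, with
  -- some parameters frozen at nonzero values.
  let T : G →ₗ[ℝ] EuclideanSpace ℝ ι :=
    (WithLp.linearEquiv 2 ℝ (ι → ℝ)).symm.toLinearMap ∘ₗ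
      LinearMap.pi fun i => IsLinearMap.mk' _ (hφ (b i))
  have hT : ∀ g, T g = WithLp.toLp 2 (c (φ g)) := fun g => rfl
  have hTinj : Function.Injective T := by
    rw [injective_iff_map_eq_zero]
    intro g hg
    refine hinj g fun x => ?_
    rw [hF]
    refine Finset.sum_eq_zero fun i _ => ?_
    have hi : c (φ g) i = 0 := by
      have := congrFun (congrArg WithLp.ofLp hg) i
      simpa [hT] using this
    rw [hi, zero_mul]
  have h := le_predRisk_of_submodule hb hb2 hiso (c := c)
    (measurable_pi_lambda _ fun i => hFθ (b i)) hF (LinearMap.range T)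
    (by rintro _ ⟨g, rfl⟩; exact ⟨φ g, rfl⟩) hn σ
  rwa [LinearMap.finrank_range_of_inj hTinj] at h

end LinearModel

/-! ### Gaussian inputs. -/

instance isProbabilityMeasure_gaussVec (d : ℕ) : IsProbabilityMeasure (gaussVec d) :=
  inferInstanceAs (IsProbabilityMeasure (Measure.pi _))

instance isProbabilityMeasure_gaussSeq (L d : ℕ) : IsProbabilityMeasure (gaussSeq L d) :=
  inferInstanceAs (IsProbabilityMeasure (Measure.pi _))

section GaussVec

variable {d : ℕ} (a : Fin d → ℝ)

theorem memLp_const_mul_gaussianReal (t : ℝ) :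
    MemLp (fun y : ℝ => t * y) 2 (gaussianReal 0 1) :=
  (memLp_id_gaussianReal 2).const_mul t

theorem integral_const_mul_gaussianReal (t : ℝ) :
    ∫ y, t * y ∂(gaussianReal 0 1) = 0 := by
  rw [integral_const_mul, show ∫ y, y ∂(gaussianReal 0 1) = 0 from integral_id_gaussianReal,
    mul_zero]

theorem memLp_sum_mul_gaussVec : MemLp (fun x : Fin d → ℝ => ∑ i, a i * x i) 2 (gaussVec d) :=
  memLp_sum_pi fun i => memLp_const_mul_gaussianReal (a i)

theorem integral_sum_mul_gaussVec : ∫ x, ∑ i, a i * x i ∂(gaussVec d) = 0 :=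
  integral_sum_pi_eq_zero (fun i => memLp_const_mul_gaussianReal (a i))
    fun i => integral_const_mul_gaussianReal (a i)

theorem integral_sq_sum_mul_gaussVec :
    ∫ x, (∑ i, a i * x i) ^ 2 ∂(gaussVec d) = ∑ i, a i ^ 2 := by
  refine (integral_sq_sum_pi (fun i => memLp_const_mul_gaussianReal (a i))
    fun i => integral_const_mul_gaussianReal (a i)).trans (Finset.sum_congr rfl fun i _ => ?_)
  simp_rw [mul_pow]
  rw [integral_const_mul, integral_sq_gaussianReal]
  simp

theorem memLp_eval_gaussVec (j : Fin d) : MemLp (fun x : Fin d → ℝ => x j) 2 (gaussVec d) :=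
  (memLp_id_gaussianReal 2).comp_measurePreserving (measurePreserving_eval _ j)

theorem integral_sq_sum_mul_gaussSeq {L : ℕ} (a : Fin L → Fin d → ℝ) :
    ∫ x, (∑ t, ∑ j, a t j * x t j) ^ 2 ∂(gaussSeq L d) = ∑ t, ∑ j, a t j ^ 2 :=
  (integral_sq_sum_pi (fun t => memLp_sum_mul_gaussVec (a t))
    fun t => integral_sum_mul_gaussVec (a t)).trans
    (Finset.sum_congr rfl fun t _ => integral_sq_sum_mul_gaussVec (a t))

end GaussVec

section Models

variable {Θ G : Type*} [MeasurableSpace Θ] [AddCommGroup G] [Module ℝ G] [Module.Finite ℝ G]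

theorem le_predRisk_gaussVec {d : ℕ} {F : (Fin d → ℝ) → Θ → ℝ}
    (hFx : ∀ θ, IsLinearMap ℝ fun x => F x θ) (hFθ : ∀ x, Measurable (F x)) (φ : G → Θ)
    (hφ : ∀ x, IsLinearMap ℝ fun g => F x (φ g)) (hinj : ∀ g, (∀ x, F x (φ g) = 0) → g = 0)
    {n : ℕ} (hn : 0 < n) (σ : ℝ≥0) :
    ENNReal.ofReal (1 / 32 * √((σ : ℝ) ^ 2 * Module.finrank ℝ G / n)) ≤
      predRisk F (gaussVec d) (gaussianReal 0 (σ ^ 2)) n := by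
  refine le_predRisk_of_injective (Pi.basisFun ℝ (Fin d)) ?_ ?_ ?_ hFx hFθ φ hφ hinj hn σ
  · intro i
    simpa using measurable_pi_apply i
  · intro i
    simpa using memLp_eval_gaussVec i
  · intro a
    simpa using integral_sq_sum_mul_gaussVec a

theorem le_predRisk_gaussSeq {L d : ℕ} {F : (Fin L → Fin d → ℝ) → Θ → ℝ}
    (hFx : ∀ θ, IsLinearMap ℝ fun x => F x θ) (hFθ : ∀ x, Measurable (F x)) (φ : G → Θ)
    (hφ : ∀ x, IsLinearMap ℝ fun g => F x (φ g)) (hinj : ∀ g, (∀ x, F x (φ g) = 0) → g = 0)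
    {n : ℕ} (hn : 0 < n) (σ : ℝ≥0) :
    ENNReal.ofReal (1 / 32 * √((σ : ℝ) ^ 2 * Module.finrank ℝ G / n)) ≤
      predRisk F (gaussSeq L d) (gaussianReal 0 (σ ^ 2)) n := by
  have hrepr : ∀ (x : Fin L → Fin d → ℝ) (i : Σ _ : Fin L, Fin d),
      (Pi.basis fun _ : Fin L => Pi.basisFun ℝ (Fin d)).repr x i = x i.1 i.2 := by
    intro x i
    simp [Pi.basis_repr]
  refine le_predRisk_of_injective (Pi.basis fun _ : Fin L => Pi.basisFun ℝ (Fin d)) ?_ ?_ ?_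
    hFx hFθ φ hφ hinj hn σ
  · intro i
    simp_rw [hrepr]
    fun_prop
  · intro i
    simp_rw [hrepr]
    exact (memLp_eval_gaussVec i.2).comp_measurePreserving (measurePreserving_eval _ i.1)
  · intro a
    simp_rw [hrepr, Fintype.sum_sigma]
    exact integral_sq_sum_mul_gaussSeq fun t j => a ⟨t, j⟩

end Models

/-! ### Convolutional networks. -/

section Convolutional

variable {d m s : ℕ} (hmd : m ≤ d)

theorem inputSegment_add (x y : Fin d → ℝ) (l : Fin ((d - m) / s + 1)) :
    inputSegment s hmd (x + y) l = inputSegment s hmd x l + inputSegment s hmd y l := rfl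

theorem inputSegment_smul (t : ℝ) (x : Fin d → ℝ) (l : Fin ((d - m) / s + 1)) :
    inputSegment s hmd (t • x) l = t • inputSegment s hmd x l := rfl

/-- Filtering the `l`-th segment of the `i`-th unit vector picks the entry of the filter that meets
coordinate `i`, if there is one. -/
theorem dotProduct_inputSegment_single (w : Fin m → ℝ) (i : Fin d)
    (l : Fin ((d - m) / s + 1)) :
    w ⬝ᵥ inputSegment s hmd (Pi.single i 1) l =
      ∑ j : Fin m, if (l : ℕ) * s + j = i then w j else 0 := by
  refine Finset.sum_congr rfl fun j _ => ?_
  simp [inputSegment, Pi.single_apply, Fin.ext_iff]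

/-- The coefficient map of the whole filter space is injective although the segments may overlap,
because it is triangular on the first `m` coordinates. -/
theorem le_predRisk_netCA (hs : 0 < s) {n : ℕ} (hn : 0 < n) (σ : ℝ≥0) :
    ENNReal.ofReal (1 / 32 * √((σ : ℝ) ^ 2 * m / n)) ≤
      predRisk (netCA s hmd) (gaussVec d) (gaussianReal 0 (σ ^ 2)) n := by
  have h := le_predRisk_gaussVec (F := netCA s hmd) (G := Fin m → ℝ) (φ := id) ?_ ?_ ?_ ?_ hn σ
  · simpa using h
  · intro w
    constructor
    · intro x y
      simp [netCA, inputSegment_add, Finset.sum_add_distrib]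
    · intro t x
      simp [netCA, inputSegment_smul, Finset.mul_sum]
  · intro x
    exact Continuous.measurable (by unfold netCA dotProduct; fun_prop)
  · intro x
    constructor
    · intro w w'
      simp [netCA, Finset.sum_add_distrib]
    · intro t w
      simp [netCA, Finset.mul_sum]
  · intro w hw
    suffices ∀ k (hk : k < m), w ⟨k, hk⟩ = 0 from funext fun j => this j j.2
    intro k
    -- Coordinate `k` meets `w k` in segment `0`; in a segment `l > 0` it can meet only `w j` with
    -- `j = k - l s < k`, which already vanishes.
    induction k using Nat.strong_induction_on with
    | _ k ih =>
      intro hk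
      have h := hw (Pi.single ⟨k, hk.trans_le hmd⟩ 1)
      simp only [netCA, id, dotProduct_inputSegment_single] at h
      rw [Finset.sum_eq_single 0, Finset.sum_eq_single ⟨k, hk⟩] at h
      · simpa using h
      · intro j _ hj
        refine if_neg fun hjk => hj (Fin.ext ?_)
        simpa using hjk
      · simp
      · intro l _ hl
        refine Finset.sum_eq_zero fun j _ => ?_
        split_ifs with hlj
        · have hl0 : 0 < (l : ℕ) := Nat.pos_of_ne_zero fun h0 => hl (Fin.ext h0)
          have hls : 0 < (l : ℕ) * s := Nat.mul_pos hl0 hs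
          exact ih j (by omega) j.2
        · rfl
      · simp

theorem isLinearMap_netCW (θ : (Fin m → ℝ) × (Fin ((d - m) / s + 1) → ℝ)) :
    IsLinearMap ℝ fun x => netCW s hmd x θ := by
  constructor
  · intro x y
    simp [netCW, inputSegment_add, mul_add, Finset.sum_add_distrib]
  · intro t x
    simp only [netCW, inputSegment_smul, dotProduct_smul, smul_eq_mul, Finset.mul_sum]
    exact Finset.sum_congr rfl fun l _ => by ring

theorem measurable_netCW (x : Fin d → ℝ) : Measurable (netCW s hmd x) :=
  Continuous.measurable (by unfold netCW dotProduct; fun_prop)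

/-- Pooling weights frozen at the first unit vector leave plain regression on the first segment. -/
theorem le_predRisk_netCW_filter {n : ℕ} (hn : 0 < n) (σ : ℝ≥0) :
    ENNReal.ofReal (1 / 32 * √((σ : ℝ) ^ 2 * m / n)) ≤
      predRisk (netCW s hmd) (gaussVec d) (gaussianReal 0 (σ ^ 2)) n := by
  have hval : ∀ x w, netCW s hmd x (w, Pi.single 0 1) = w ⬝ᵥ inputSegment s hmd x 0 := by
    intro x w
    rw [netCW, Finset.sum_eq_single 0]
    · simp
    · intro l _ hl
      simp [hl]
    · simp
  have h := le_predRisk_gaussVec (F := netCW s hmd) (G := Fin m → ℝ)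
    (φ := fun w => (w, Pi.single 0 1)) (isLinearMap_netCW hmd) (measurable_netCW hmd) ?_ ?_ hn σ
  · simpa using h
  · intro x
    simp_rw [hval]
    exact ⟨fun w w' => add_dotProduct _ _ _, fun t w => smul_dotProduct _ _ _⟩
  · intro w hw
    funext j
    have h := hw (Pi.single ⟨j, j.2.trans_le hmd⟩ 1)
    rw [hval, dotProduct_inputSegment_single, Finset.sum_eq_single j] at h
    · simpa using h
    · intro k _ hk
      refine if_neg fun hjk => hk (Fin.ext ?_)
      simpa using hjk
    · simp

/-- With the filter frozen at its first unit vector, the weight `a l` multiplies the coordinate `l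
s`, and these coordinates are distinct since `s > 0`. -/
theorem le_predRisk_netCW_pooling (hm : 0 < m) (hs : 0 < s) {n : ℕ} (hn : 0 < n) (σ : ℝ≥0) :
    ENNReal.ofReal (1 / 32 * √((σ : ℝ) ^ 2 * ((d - m) / s + 1 : ℕ) / n)) ≤
      predRisk (netCW s hmd) (gaussVec d) (gaussianReal 0 (σ ^ 2)) n := by
  have h := le_predRisk_gaussVec (F := netCW s hmd) (G := Fin ((d - m) / s + 1) → ℝ)
    (φ := fun a => (Pi.single ⟨0, hm⟩ 1, a)) (isLinearMap_netCW hmd) (measurable_netCW hmd)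
    ?_ ?_ hn σ
  · rwa [Module.finrank_fin_fun] at h
  · intro x
    constructor
    · intro a a'
      simp [netCW, add_mul, Finset.sum_add_distrib]
    · intro t a
      simp only [netCW, Pi.smul_apply, smul_eq_mul, Finset.mul_sum]
      exact Finset.sum_congr rfl fun l _ => by ring
  · intro a ha
    funext l
    have h := ha (Pi.single ⟨_, segment_index_lt hmd l ⟨0, hm⟩⟩ 1)
    simp only [netCW, single_dotProduct, inputSegment, Pi.single_apply, Fin.ext_iff, one_mul] at h
    rw [Finset.sum_eq_single l] at h
    · simpa using h
    · intro k _ hk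
      rw [if_neg, mul_zero]
      intro hkl
      exact hk (Fin.ext (Nat.eq_of_mul_eq_mul_right hs (by simpa using hkl)))
    · simp

theorem le_predRisk_netCW (hm : 0 < m) (hs : 0 < s) (hsd : s ∣ d) (hsm : s ∣ m) {n : ℕ}
    (hn : 0 < n) (σ : ℝ≥0) :
    ENNReal.ofReal (1 / 64 * √((σ : ℝ) ^ 2 * ((m : ℝ) + (d : ℝ) / (s : ℝ)) / (n : ℝ))) ≤
      predRisk (netCW s hmd) (gaussVec d) (gaussianReal 0 (σ ^ 2)) n := by
  have hn0 : (0 : ℝ) < n := by exact_mod_cast hn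
  -- With `d = s a` and `m = s b`, `a ≤ (a - b) + b` and `b ≤ m`, so the factor `3` would do; `4`
  -- has an exact square root and halves `1 / 32`.
  have hcount : m + d / s ≤ 4 * max m ((d - m) / s + 1) := by
    obtain ⟨a, rfl⟩ := hsd
    obtain ⟨b, rfl⟩ := hsm
    rw [← Nat.mul_sub, Nat.mul_div_cancel_left _ hs, Nat.mul_div_cancel_left _ hs]
    have : b ≤ s * b := Nat.le_mul_of_pos_left b hs
    omega
  have hcount' : (m : ℝ) + d / s ≤ 4 * (max m ((d - m) / s + 1) : ℕ) := by
    rw [← Nat.cast_div hsd (by exact_mod_cast hs.ne')]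
    exact_mod_cast hcount
  have hle : 1 / 64 * √((σ : ℝ) ^ 2 * ((m : ℝ) + (d : ℝ) / (s : ℝ)) / (n : ℝ)) ≤
      1 / 32 * √((σ : ℝ) ^ 2 * (max m ((d - m) / s + 1) : ℕ) / n) := by
    have h4 : √((σ : ℝ) ^ 2 * ((m : ℝ) + (d : ℝ) / (s : ℝ)) / (n : ℝ)) ≤
        √(2 ^ 2 * ((σ : ℝ) ^ 2 * (max m ((d - m) / s + 1) : ℕ) / n)) := by
      apply Real.sqrt_le_sqrt
      rw [← mul_div_assoc]
      refine div_le_div_of_nonneg_right ?_ hn0.le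
      linarith [mul_le_mul_of_nonneg_left hcount' (sq_nonneg (σ : ℝ))]
    rw [Real.sqrt_mul (by positivity), Real.sqrt_sq (by norm_num)] at h4
    linarith
  refine (ENNReal.ofReal_le_ofReal hle).trans ?_
  rcases max_choice m ((d - m) / s + 1) with h | h <;> rw [h]
  · exact le_predRisk_netCW_filter hmd hn σ
  · exact le_predRisk_netCW_pooling hmd hm hs hn σ

end Convolutional

/-! ### Linear recurrent networks. -/

section Recurrent

variable {r d : ℕ}

theorem rnnState_eq_sum (A : Matrix (Fin r) (Fin r) ℝ) (B : Matrix (Fin r) (Fin d) ℝ) (L : ℕ)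
    (x : Fin L → Fin d → ℝ) :
    rnnState A B L x = ∑ t : Fin L, A ^ (L - 1 - t) *ᵥ (B *ᵥ x t) := by
  induction L with
  | zero => simp [rnnState]
  | succ L ih =>
    rw [rnnState, ih, Fin.sum_univ_castSucc, Matrix.mulVec_sum]
    congr 1
    · refine Finset.sum_congr rfl fun t _ => ?_
      rw [Matrix.mulVec_mulVec, ← pow_succ']
      congr 2
      have := t.2
      simp only [Fin.val_castSucc]
      omega
    · simp

theorem netR_eq_sum {L : ℕ} (x : Fin L → Fin d → ℝ)
    (θ : (Fin r → Fin r → ℝ) × (Fin r → Fin d → ℝ)) :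
    netR r x θ =
      ∑ i, ∑ t : Fin L, (Matrix.of θ.1 ^ (L - 1 - t) *ᵥ (Matrix.of θ.2 *ᵥ x t)) i := by
  simp [netR, rnnState_eq_sum]

/-- With `A = diag(0, …, r - 1)`, the coefficient of input coordinate `j` at lag `k` from the end is
the power sum `∑ i, i ^ k * B i j`. The first `min r L` lags determine that many entries in column
`j` of `B` by Vandermonde, the other rows being set to zero. -/
theorem le_predRisk_netR (L : ℕ) {n : ℕ} (hn : 0 < n) (σ : ℝ≥0) :
    ENNReal.ofReal (1 / 32 * √((σ : ℝ) ^ 2 * (min r L * d : ℕ) / n)) ≤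
      predRisk (netR r) (gaussSeq L d) (gaussianReal 0 (σ ^ 2)) n := by
  let ε : (Fin (min r L) → ℝ) →ₗ[ℝ] (Fin r → ℝ) :=
    Function.ExtendByZero.linearMap ℝ (Fin.castLE (min_le_left r L))
  let D : Fin r → Fin r → ℝ := Matrix.diagonal fun i => ((i : ℕ) : ℝ)
  let φ : (Fin (min r L) → Fin d → ℝ) → (Fin r → Fin r → ℝ) × (Fin r → Fin d → ℝ) :=
    fun b => (D, fun i j => ε (fun k => b k j) i)
  have h := le_predRisk_gaussSeq (L := L) (d := d) (F := netR r) (φ := φ) ?_ ?_ ?_ ?_ hn σ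
  · have hfr : Module.finrank ℝ (Fin (min r L) → Fin d → ℝ) = min r L * d := by
      simp [Module.finrank_pi_fintype]
    rwa [hfr] at h
  · intro θ
    simp_rw [netR_eq_sum]
    constructor
    · intro x y
      simp [Matrix.mulVec_add, Finset.sum_add_distrib]
    · intro t x
      simp [Matrix.mulVec_smul, Finset.mul_sum]
  · intro x
    have hc : Continuous (netR r x) := by
      simp_rw [funext (netR_eq_sum x)]
      refine continuous_finsetSum _ fun i _ => continuous_finsetSum _ fun t _ => ?_
      have hA : Continuous fun θ : (Fin r → Fin r → ℝ) × (Fin r → Fin d → ℝ) =>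
          Matrix.of θ.1 ^ (L - 1 - t) := Continuous.pow (by exact continuous_fst) _
      have hB : Continuous fun θ : (Fin r → Fin r → ℝ) × (Fin r → Fin d → ℝ) =>
          Matrix.of θ.2 := by exact continuous_snd
      exact (continuous_apply i).comp (hA.matrix_mulVec (hB.matrix_mulVec continuous_const))
    exact hc.measurable
  · have hadd : ∀ b b', Matrix.of (φ (b + b')).2 = Matrix.of (φ b).2 + Matrix.of (φ b').2 := by
      intro b b'
      ext i j
      exact congrFun (map_add ε (fun k => b k j) fun k => b' k j) i
    have hsmul : ∀ (t : ℝ) b, Matrix.of (φ (t • b)).2 = t • Matrix.of (φ b).2 := by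
      intro t b
      ext i j
      exact congrFun (map_smul ε t fun k => b k j) i
    intro x
    have hD : ∀ b, (φ b).1 = D := fun b => rfl
    simp_rw [netR_eq_sum, hD]
    constructor
    · intro b b'
      simp only [hadd, Matrix.mulVec_add, Matrix.add_mulVec, Pi.add_apply, Finset.sum_add_distrib]
    · intro t b
      simp only [hsmul, Matrix.mulVec_smul, Matrix.smul_mulVec, Pi.smul_apply, smul_eq_mul,
        Finset.mul_sum]
  · intro b hb
    funext k j
    revert k
    refine fun k => congrFun (Matrix.eq_zero_of_forall_pow_sum_mul_pow_eq_zero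
      (f := fun i : Fin (min r L) => ((i : ℕ) : ℝ)) (v := fun i => b i j)
      (fun i i' h => Fin.ext (Nat.cast_injective h)) fun k => ?_) k
    have hkL : (k : ℕ) < L := k.2.trans_le (min_le_right r L)
    -- Times are numbered from `0`, so an impulse at time `L - 1 - k` is multiplied by `A ^ k`. For
    -- `k = 0` the zero diagonal entry contributes through `0 ^ 0 = 1`.
    have hx := hb (Pi.single ⟨L - 1 - k, by omega⟩ (Pi.single j 1))
    have hterm : ∀ i : Fin r, ∑ t : Fin L, (Matrix.of D ^ (L - 1 - t) *ᵥ
        (Matrix.of (φ b).2 *ᵥ (Pi.single (M := fun _ : Fin L => Fin d → ℝ) ⟨L - 1 - k, by omega⟩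
          (Pi.single j 1) t))) i = ε (fun k => b k j) i * ((i : ℕ) : ℝ) ^ (k : ℕ) := by
      intro i
      rw [Finset.sum_eq_single ⟨L - 1 - k, by omega⟩]
      · rw [show Matrix.of D = Matrix.diagonal fun i : Fin r => ((i : ℕ) : ℝ) from rfl,
          Matrix.diagonal_pow, Matrix.mulVec_diagonal]
        have : L - 1 - (L - 1 - (k : ℕ)) = k := by omega
        simp [this, φ, mul_comm]
      · intro t _ ht
        simp [ht]
      · simp
    rw [netR_eq_sum] at hx
    rw [Finset.sum_congr rfl fun i _ => hterm i] at hx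
    rw [← hx]
    refine Finset.sum_of_injOn (Fin.castLE (min_le_left r L))
      (Fin.castLE_injective _).injOn (by simp) ?_ ?_
    · intro i _ hi
      have : ε (fun k => b k j) i = 0 :=
        Function.extend_apply' (f := Fin.castLE (min_le_left r L)) (fun k => b k j) 0 i
          fun ⟨k', hk'⟩ => hi ⟨k', by simp, hk'⟩
      rw [this, zero_mul]
    · intro i _
      have : ε (fun k => b k j) (Fin.castLE (min_le_left r L) i) = b i j :=
        (Fin.castLE_injective (min_le_left r L)).extend_apply (fun k => b k j) 0 i
      rw [this]
      simp

end Recurrent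

end

theorem theorem2 :
    ∃ C : ℝ, 0 < C ∧
      (∀ (d m s n : ℕ) (σ : ℝ≥0) (hmd : m ≤ d), 0 < m → 0 < s → s ∣ d → s ∣ m → 0 < n →
        ENNReal.ofReal (C * √((σ : ℝ) ^ 2 * (m : ℝ) / (n : ℝ))) ≤
          predRisk (netCA s hmd) (gaussVec d) (gaussianReal 0 (σ ^ 2)) n) ∧
      (∀ (d m s n : ℕ) (σ : ℝ≥0) (hmd : m ≤ d), 0 < m → 0 < s → s ∣ d → s ∣ m → 0 < n →
        ENNReal.ofReal (C * √((σ : ℝ) ^ 2 * ((m : ℝ) + (d : ℝ) / (s : ℝ)) / (n : ℝ))) ≤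
          predRisk (netCW s hmd) (gaussVec d) (gaussianReal 0 (σ ^ 2)) n) ∧
      (∀ (d r L n : ℕ) (σ : ℝ≥0), 0 < n →
        ENNReal.ofReal
            (C * √((σ : ℝ) ^ 2 * min ((r : ℝ) * (d : ℝ)) ((L : ℝ) * (d : ℝ)) / (n : ℝ))) ≤
          predRisk (netR r) (gaussSeq L d) (gaussianReal 0 (σ ^ 2)) n) := by
  have hC : ∀ y : ℝ, ENNReal.ofReal (1 / 64 * √y) ≤ ENNReal.ofReal (1 / 32 * √y) := fun y =>
    ENNReal.ofReal_le_ofReal (by linarith [Real.sqrt_nonneg y])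
  -- The smallest of the three constants, coming from weighted pooling.
  refine ⟨1 / 64, by norm_num, ?_, ?_, ?_⟩
  · intro d m s n σ hmd _ hs _ _ hn
    exact (hC _).trans (le_predRisk_netCA hmd hs hn σ)
  · intro d m s n σ hmd hm hs hsd hsm hn
    exact le_predRisk_netCW hmd hm hs hsd hsm hn σ
  · intro d r L n σ hn
    have h := le_predRisk_netR (r := r) (d := d) L hn σ
    rw [Nat.cast_mul, Nat.cast_min, min_mul_of_nonneg _ _ (Nat.cast_nonneg d)] at h
    exact (hC _).trans h
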